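/- Let $\mathcal{C}$ be a (not necessarily unital) C*-algebra and let $E \subseteq \mathcal{C}$ be a selfadjoint operator space, i.e. a norm-closed linear subspace with $E^* = E$. For $n \in \mathbb{N}$, the space $M_n(E) \subseteq M_n(\mathcal{C})$ carries the norm, the involution and the cone $M_n(E)_+ := M_n(E) \cap M_n(\mathcal{C})_+$ inherited from the C*-algebra $M_n(\mathcal{C})$; write $M_n(E)_{sa}$ for its selfadjoint elements, and $\operatorname{dist}$ for the distance in the norm of $M_n(\mathcal{C})$. In particular $M_n(E)$ is itself a selfadjoint operator space in $M_n(\mathcal{C})$. A linear map between $*$-vector spaces with matrix cones is completely positive if it is selfadjoint and each of its entrywise amplifications maps positive matrices to positive matrices; it is a complete order embedding if moreover it is injective and its inverse on its image is completely positive. The unitisation of a selfadjoint operator space $E$ is $E^\# := E \oplus \mathbb{C}$ with involution $(x,a)^* = (x^*, \overline{a})$, where a selfadjoint $(x,a) \in M_n(E^\#) = M_n(E) \oplus M_n(\mathbb{C})$ is positive if $a \ge 0$ and $\varphi(a_\varepsilon^{-1/2} x a_\varepsilon^{-1/2}) \ge -1$ for all $\varepsilon > 0$ and all completely contractive completely positive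 $\varphi \colon M_n(E) \to \mathbb{C}$, with $a_\varepsilon := a + \varepsilon I_{M_n}$. A linear map $\vartheta \colon E \to F$ between selfadjoint operator spaces is an embedding if it is a completely isometric complete order embedding and its unitisation $\vartheta^\# \colon E^\# \to F^\#$, $(x,a) \mapsto (\vartheta(x), a)$, is a complete order embedding. Then the inclusion $E \subseteq \mathcal{C}$ is an embedding if and only if, for every $n \in \mathbb{N}$ and every $x \in M_n(E)_{sa}$, \[ \operatorname{dist}(x, M_n(E)_+) = \max\{ -\lambda : \lambda \in \sigma_{M_n(\mathcal{C})}(x) \cup \{0\} \}, \] where $\sigma_{M_n(\mathcal{C})}(x)$ is the spectrum of $x$, computed in the unitisation of $M_n(\mathcal{C})$ if $M_n(\mathcal{C})$ is not unital. -/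

import Mathlib

open scoped ComplexOrder

/-- A (concrete) selfadjoint operator space in a C*-algebra `A`: a norm-closed selfadjoint complex
linear subspace of `A`. -/
structure SelfadjointOperatorSpace (A : Type*) [NonUnitalCStarAlgebra A] extends
    Submodule ℂ A where
  star_mem' : ∀ x ∈ carrier, star x ∈ carrier
  isClosed' : IsClosed carrier

namespace SelfadjointOperatorSpace

section Basic

variable {A : Type*} [NonUnitalCStarAlgebra A]

instance instCoeSort : CoeSort (SelfadjointOperatorSpace A) (Type _) :=
  ⟨fun E => E.toSubmodule⟩

/-- The involution of a selfadjoint operator space. -/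
instance instStar (E : SelfadjointOperatorSpace A) : Star E :=
  ⟨fun x => ⟨star (x : A), E.star_mem' _ x.2⟩⟩

variable (A) in
/-- A C*-algebra, viewed as a selfadjoint operator space in itself. -/
def univ : SelfadjointOperatorSpace A where
  toSubmodule := ⊤
  star_mem' := fun _ _ => trivial
  isClosed' := isClosed_univ

/-- The inclusion `E ⊆ A`, as a linear map between selfadjoint operator spaces. -/
def inclusion (E : SelfadjointOperatorSpace A) : E →ₗ[ℂ] univ A :=
  Submodule.inclusion (p := E.toSubmodule) (p' := (univ A).toSubmodule) le_top

/-- A matrix over `E`, as an element of the C*-algebra `M_n(A)`. -/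
def toAmbient (E : SelfadjointOperatorSpace A) {n : ℕ} (X : Matrix (Fin n) (Fin n) E) :
    CStarMatrix (Fin n) (Fin n) A :=
  CStarMatrix.ofMatrix (X.map Subtype.val)

variable [PartialOrder A] [StarOrderedRing A]

/-- `M_n(E)` as a selfadjoint operator space in the C*-algebra `M_n(A)`. -/
def mat (E : SelfadjointOperatorSpace A) (n : ℕ) :
    SelfadjointOperatorSpace (CStarMatrix (Fin n) (Fin n) A) where
  carrier := {X | ∀ i j, X i j ∈ E.toSubmodule}
  add_mem' := fun hX hY i j => E.toSubmodule.add_mem (hX i j) (hY i j)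
  zero_mem' := fun _ _ => E.toSubmodule.zero_mem
  smul_mem' := fun c _ hX i j => E.toSubmodule.smul_mem c (hX i j)
  star_mem' := fun _ hX i j => E.star_mem' _ (hX j i)
  isClosed' := by
    have h : IsClosed {X : Matrix (Fin n) (Fin n) A | ∀ i j, X i j ∈ E.carrier} := by
      simp only [Set.ofPred_forall]
      exact isClosed_iInter fun i => isClosed_iInter fun j =>
        E.isClosed'.preimage ((continuous_apply j).comp (continuous_apply i))
    exact h

/-- The cone `M_n(E)_+ = M_n(E) ∩ M_n(A)_+`, as a subset of `M_n(A)`. -/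
def posCone (E : SelfadjointOperatorSpace A) (n : ℕ) : Set (CStarMatrix (Fin n) (Fin n) A) :=
  {P | P ∈ (E.mat n).toSubmodule ∧ 0 ≤ P}

/-- The matrix cones of `E`, as subsets of `M_n(E)`. -/
def matrixCone (E : SelfadjointOperatorSpace A) (n : ℕ) : Set (Matrix (Fin n) (Fin n) E) :=
  {X | 0 ≤ E.toAmbient X}

/-- The matrix norms of `E`, inherited from those of `A`. -/
noncomputable def matrixNorm (E : SelfadjointOperatorSpace A) (n : ℕ)
    (X : Matrix (Fin n) (Fin n) E) : ℝ :=
  ‖E.toAmbient X‖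

end Basic

section Maps

variable {V W : Type*} [AddCommGroup V] [Module ℂ V] [Star V] [AddCommGroup W] [Module ℂ W] [Star W]

/-- Complete positivity of a linear map, with respect to given families of matrix cones: the map is
selfadjoint, and all its entrywise amplifications preserve the cones. -/
def IsCompletelyPositive (C : ∀ n : ℕ, Set (Matrix (Fin n) (Fin n) V))
    (D : ∀ n : ℕ, Set (Matrix (Fin n) (Fin n) W)) (φ : V →ₗ[ℂ] W) : Prop :=
  (∀ x, φ (star x) = star (φ x)) ∧ ∀ (n : ℕ), ∀ X ∈ C n, X.map φ ∈ D n

/-- A complete order embedding: a completely positive map that is injective and whose inverse is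
completely positive on the image (with the cones inherited from the codomain). -/
def IsCompleteOrderEmbedding (C : ∀ n : ℕ, Set (Matrix (Fin n) (Fin n) V))
    (D : ∀ n : ℕ, Set (Matrix (Fin n) (Fin n) W)) (φ : V →ₗ[ℂ] W) : Prop :=
  IsCompletelyPositive C D φ ∧ Function.Injective φ ∧
    ∀ (n : ℕ) (X : Matrix (Fin n) (Fin n) V), X.map φ ∈ D n → X ∈ C n

end Maps

section Unitisation

open scoped MatrixOrder

variable {A B : Type*} [NonUnitalCStarAlgebra A] [PartialOrder A] [StarOrderedRing A]
  [NonUnitalCStarAlgebra B] [PartialOrder B] [StarOrderedRing B]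

/-- Completely contractive completely positive maps between selfadjoint operator spaces. -/
def IsCCP (E : SelfadjointOperatorSpace A) (F : SelfadjointOperatorSpace B)
    (φ : E →ₗ[ℂ] F) : Prop :=
  IsCompletelyPositive E.matrixCone F.matrixCone φ ∧
    ∀ (n : ℕ) (X : Matrix (Fin n) (Fin n) E), F.matrixNorm n (X.map φ) ≤ E.matrixNorm n X

/-- Completely isometric maps between selfadjoint operator spaces. -/
def IsCompletelyIsometric (E : SelfadjointOperatorSpace A) (F : SelfadjointOperatorSpace B)
    (φ : E →ₗ[ℂ] F) : Prop :=
  ∀ (n : ℕ) (X : Matrix (Fin n) (Fin n) E), F.matrixNorm n (X.map φ) = E.matrixNorm n X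

/-- The element `b x b` of `M_n(E)`, for `x ∈ M_n(E)` and a scalar matrix `b ∈ M_n(ℂ)`. -/
def sandwich (E : SelfadjointOperatorSpace A) {n : ℕ} (b : Matrix (Fin n) (Fin n) ℂ)
    (X : Matrix (Fin n) (Fin n) E) : E.mat n :=
  ⟨E.toAmbient fun i j => ∑ k, ∑ l, (b i k * b l j) • X k l, fun _ _ => Subtype.property _⟩

/-- The matrix cones of Werner's unitisation `E^# = E ⊕ ℂ`.  The space `E^#` is the type `E × ℂ`,
with its componentwise linear structure and involution, and a matrix `u` over it is a pair `(x, a)`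
with `x ∈ M_n(E)` and `a ∈ M_n(ℂ)`.  It is positive if it is selfadjoint, `a ≥ 0`, and
`φ(a_ε^{-1/2} x a_ε^{-1/2}) ≥ -1` for all `ε > 0` and all completely contractive completely positive
`φ : M_n(E) → ℂ`, where `a_ε = a + ε 1`.  The power is that of the continuous functional calculus of
matrices; such a `φ` is selfadjoint, so its value here is real. -/
def unitisationCone (E : SelfadjointOperatorSpace A) (n : ℕ) :
    Set (Matrix (Fin n) (Fin n) (E × ℂ)) :=
  {u | (∀ i j, u j i = star (u i j)) ∧
    (u.map Prod.snd).PosSemidef ∧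
    ∀ ε : ℝ, 0 < ε → ∀ φ : E.mat n →ₗ[ℂ] univ ℂ, IsCCP (E.mat n) (univ ℂ) φ →
      -1 ≤ (φ (E.sandwich
        ((u.map Prod.snd + (ε : ℂ) • (1 : Matrix (Fin n) (Fin n) ℂ)) ^ (-(1 / 2) : ℝ))
        (u.map Prod.fst)) : ℂ).re}

/-- The unitisation `θ^# : E^# → F^#`, `(x, a) ↦ (θ x, a)`. -/
def unitisationMap (E : SelfadjointOperatorSpace A) (F : SelfadjointOperatorSpace B)
    (θ : E →ₗ[ℂ] F) : E × ℂ →ₗ[ℂ] F × ℂ :=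
  LinearMap.prodMap θ LinearMap.id

/-- An embedding of selfadjoint operator spaces: a completely isometric complete order embedding
whose unitisation (a unital map by construction) is a complete order embedding. -/
def IsEmbedding (E : SelfadjointOperatorSpace A) (F : SelfadjointOperatorSpace B)
    (θ : E →ₗ[ℂ] F) : Prop :=
  IsCompletelyIsometric E F θ ∧
    IsCompleteOrderEmbedding E.matrixCone F.matrixCone θ ∧
    IsCompleteOrderEmbedding E.unitisationCone F.unitisationCone (unitisationMap E F θ)

end Unitisation

end SelfadjointOperatorSpace

/-! Both conditions say that, for selfadjoint `x` in `M_n(E)`, the distances to `M_n(E)_+` and to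
`M_n(C)_+` agree. On the spectral side, the distance from `x` to the full cone `M_n(C)_+` is `‖x⁻‖`,
which is the largest `-λ` with `λ` in the quasispectrum (`infDist_nonneg_eq_norm_negPart`,
`isGreatest_neg_mem_quasispectrum`). On the order side, Hahn–Banach gives `dist(y, V_+) = max
(-φ(y))` over completely contractive completely positive functionals `φ`
(`exists_isCCP_re_apply_eq_neg_infDist`). The functional condition in the cone of `E^#` thus becomes
a bound by 1 on the distance from `a_ε^{-1/2} x a_ε^{-1/2}` to `M_n(E)_+`. Equal distances therefore
give equal unitisation cones; conversely, the elements `(x, d·1)` recover the distances from the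
cones. -/

/-! ### Negative parts: spectrum and distance to the positive cone. -/

section NegPart

variable {B : Type*} [NonUnitalCStarAlgebra B]

/-- The C*-identity applied twice gives `‖z‖ ^ 4 = ‖star z * z * star z * z‖`, and one factor `‖z‖`
is split off. Multiplying by `z` itself replaces testing against a unit. -/
lemma norm_star_mul_mul_star (z : B) : ‖star z * z * star z‖ = ‖z‖ ^ 3 := by
  rcases eq_or_ne z 0 with rfl | hz
  · simp
  have hz' : 0 < ‖z‖ := norm_pos_iff.mpr hz
  apply le_antisymm
  · calc ‖star z * z * star z‖ ≤ ‖star z * z‖ * ‖star z‖ := norm_mul_le _ _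
      _ = ‖z‖ ^ 3 := by rw [CStarRing.norm_star_mul_self, norm_star]; ring
  · have h : ‖star (star z * z) * (star z * z)‖ = ‖z‖ ^ 4 := by
      rw [CStarRing.norm_star_mul_self, CStarRing.norm_star_mul_self]; ring
    have h' : ‖star z * z * star z * z‖ = ‖z‖ ^ 4 := by
      rw [← h]; simp [mul_assoc]
    have h2 : ‖z‖ ^ 3 * ‖z‖ ≤ ‖star z * z * star z‖ * ‖z‖ := by
      calc ‖z‖ ^ 3 * ‖z‖ = ‖star z * z * star z * z‖ := by rw [h']; ring
        _ ≤ _ := norm_mul_le _ _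
    exact le_of_mul_le_mul_right h2 hz'

lemma isGreatest_neg_mem_quasispectrum (x : B) (hx : IsSelfAdjoint x) :
    IsGreatest {t : ℝ | -(t : ℂ) ∈ quasispectrum ℂ x} ‖x⁻‖ := by
  have hset : {t : ℝ | -(t : ℂ) ∈ quasispectrum ℂ x} = {t : ℝ | -t ∈ quasispectrum ℝ x} := by
    ext t
    have := quasispectrum.algebraMap_mem_iff ℂ (R := ℝ) (a := x) (r := -t)
    simpa using this
  rw [hset, CFC.negPart_def]
  obtain ⟨⟨s, hs, hs'⟩, hub⟩ := IsGreatest.norm_cfcₙ (fun r : ℝ => r⁻) x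
  constructor
  -- The norm is attained at `s`. If `s ≥ 0` it vanishes and the witness is 0, which always lies in
  -- the quasispectrum; this accounts for the `∪ {0}`.
  · rcases le_total 0 s with h | h
    · have h0 : s⁻ = 0 := negPart_eq_zero.mpr h
      have : ‖cfcₙ (fun r : ℝ => r⁻) x‖ = 0 := by rw [← hs']; simp [h0]
      simp only [Set.mem_ofPred_eq, this, neg_zero]
      exact quasispectrum.zero_mem ℝ x
    · have h0 : s⁻ = -s := negPart_of_nonpos h
      have : ‖cfcₙ (fun r : ℝ => r⁻) x‖ = -s := by
        rw [← hs']; simp only [h0, norm_neg, Real.norm_eq_abs, abs_of_nonpos h]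
      simpa [this] using hs
  · intro t ht
    refine le_trans ?_ (hub ⟨-t, ht, rfl⟩)
    exact (neg_le_negPart (-t)).trans' (by simp) |>.trans (le_abs_self _)

variable [PartialOrder B] [StarOrderedRing B]

/-- Compressing `P - x` by `x⁻` kills the positive part of `x` and leaves at least `(x⁻)³`;
comparing norms and cancelling `‖x⁻‖ ^ 2` gives the bound. -/
lemma norm_negPart_le_norm_sub (x : B) (hx : IsSelfAdjoint x) {P : B} (hP : 0 ≤ P) :
    ‖x⁻‖ ≤ ‖x - P‖ := by
  have hn : 0 ≤ x⁻ := CFC.negPart_nonneg x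
  have hns : IsSelfAdjoint x⁻ := .of_nonneg hn
  have h1 : x⁻ * x⁻ * x⁻ ≤ x⁻ * (P - x) * x⁻ := by
    have h2 : x⁻ * (P - x) * x⁻ = x⁻ * P * x⁻ + x⁻ * x⁻ * x⁻ := by
      nth_rw 2 [← CFC.posPart_sub_negPart x hx]
      simp only [mul_sub, sub_mul, mul_assoc, CFC.posPart_mul_negPart, mul_zero]
      abel
    rw [h2]
    exact le_add_of_nonneg_left (hns.conjugate_nonneg hP)
  have h3 := CStarAlgebra.norm_le_norm_of_nonneg_of_le (hns.conjugate_nonneg hn) h1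
  have h4 := norm_star_mul_mul_star x⁻
  rw [hns.star_eq] at h4
  rw [h4] at h3
  rcases (norm_nonneg x⁻).eq_or_lt with h | h
  · rw [← h]; exact norm_nonneg _
  · have h5 : ‖x⁻ * (P - x) * x⁻‖ ≤ ‖x⁻‖ * ‖x - P‖ * ‖x⁻‖ :=
      (norm_mul_le _ _).trans (by
        rw [norm_sub_rev x P]; gcongr; exact norm_mul_le _ _)
    have : ‖x⁻‖ * ‖x⁻‖ ^ 2 ≤ ‖x - P‖ * ‖x⁻‖ ^ 2 := by nlinarith
    exact le_of_mul_le_mul_right this (by positivity)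

lemma infDist_nonneg_eq_norm_negPart (x : B) (hx : IsSelfAdjoint x) :
    Metric.infDist x {P : B | 0 ≤ P} = ‖x⁻‖ := by
  apply le_antisymm
  · calc Metric.infDist x {P : B | 0 ≤ P} ≤ dist x x⁺ :=
          Metric.infDist_le_dist_of_mem (CFC.posPart_nonneg x)
      _ = ‖x⁻‖ := by
          rw [dist_eq_norm, norm_sub_rev, sub_eq_of_eq_add]
          rw [add_comm]
          exact sub_eq_iff_eq_add.mp (CFC.posPart_sub_negPart x hx)
  · rw [Metric.le_infDist (s := {P : B | 0 ≤ P}) ⟨0, le_refl (0 : B)⟩]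
    intro P hP
    rw [dist_eq_norm]
    exact norm_negPart_le_norm_sub x hx hP

end NegPart

/-! ### Scalar compressions of matrices over a C*-algebra. -/

section ScalarVectors

lemma exists_eq_star_mul_self_of_nonneg {B : Type*} [NonUnitalCStarAlgebra B] [PartialOrder B]
    [StarOrderedRing B] {a : B} (ha : 0 ≤ a) : ∃ b, a = star b * b :=
  CStarAlgebra.nonneg_iff_eq_star_mul_self.mp ha

open CStarMatrix

variable {B : Type*} [NonUnitalCStarAlgebra B] [PartialOrder B] [StarOrderedRing B]
  {k : Type*} [Fintype k]

/-- Without a unit, scalar vectors do not embed in the module `B^k`. They are instead multiplied by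
`star z` and `z`, where `z` is the sum to be estimated: the inner product becomes `star z * z * star
z`, of norm `‖z‖ ^ 3`, and Cauchy–Schwarz applies. -/
lemma CStarMatrix.norm_sum_smul_le (X : CStarMatrix k k B)
    (v w : WithCStarModule ℂ (k → ℂ)) :
    ‖∑ i, ∑ j, (v i * star (w j)) • X i j‖ ≤ ‖X‖ * ‖v‖ * ‖w‖ := by
  set z := ∑ i, ∑ j, (v i * star (w j)) • X i j with hz
  let lift (c : WithCStarModule ℂ (k → ℂ)) (a : B) : WithCStarModule B (k → B) :=
    (WithCStarModule.equiv B (k → B)).symm fun i => c i • a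
  have hlift (c : WithCStarModule ℂ (k → ℂ)) (a : B) : ‖lift c a‖ = ‖c‖ * ‖a‖ := by
    rw [← sq_eq_sq₀ (norm_nonneg _) (by positivity), WithCStarModule.pi_norm_sq, mul_pow,
      WithCStarModule.pi_norm_sq]
    simp only [WithCStarModule.inner_def]
    have : ∑ i, lift c a i * star (lift c a i) = (∑ i, c i * star (c i)) • (a * star a) := by
      simp [lift, Finset.sum_smul, smul_mul_smul_comm]
    rw [this, norm_smul, CStarRing.norm_self_mul_star, sq ‖a‖]
  have hinner : inner B (lift w z) (toCLM X (lift v (star z))) = star z * z * star z := by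
    have hr : star z * z * star z =
        ∑ i, ∑ j, (v i * star (w j)) • (star z * X i j * star z) := by
      nth_rw 2 [hz]
      simp only [Finset.sum_mul, Finset.mul_sum, smul_mul_assoc, mul_smul_comm]
    rw [hr, Finset.sum_comm]
    simp only [WithCStarModule.pi_inner, WithCStarModule.inner_def, toCLM_apply_eq_sum, lift,
      WithCStarModule.equiv_symm_pi_apply, Finset.sum_mul, star_smul, smul_mul_assoc,
      mul_smul_comm]
    refine Finset.sum_congr rfl fun j _ => Finset.smul_sum.trans ?_
    refine Finset.sum_congr rfl fun i _ => ?_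
    rw [mul_comm]
    exact smul_smul (star (w j)) (v i) (star z * X i j * star z)
  have h1 : ‖z‖ ^ 3 ≤ ‖w‖ * ‖z‖ * (‖X‖ * (‖v‖ * ‖z‖)) := by
    calc ‖z‖ ^ 3 = ‖inner B (lift w z) (toCLM X (lift v (star z)))‖ := by
          rw [hinner, norm_star_mul_mul_star]
      _ ≤ ‖lift w z‖ * ‖toCLM X (lift v (star z))‖ := CStarModule.norm_inner_le _
      _ ≤ ‖lift w z‖ * (‖X‖ * ‖lift v (star z)‖) := by
          gcongr; exact (toCLM X).le_opNorm _
      _ = _ := by rw [hlift, hlift, norm_star]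
  rcases (norm_nonneg z).eq_or_lt with h | h
  · rw [← h]; positivity
  · have : ‖z‖ * ‖z‖ ^ 2 ≤ (‖X‖ * ‖v‖ * ‖w‖) * ‖z‖ ^ 2 := by nlinarith
    exact le_of_mul_le_mul_right this (by positivity)

/-- Writing `X = star Y * Y` turns the sum into a sum of squares, one for each row of `Y`. -/
lemma CStarMatrix.sum_smul_nonneg {X : CStarMatrix k k B} (hX : 0 ≤ X) (c : k → ℂ) :
    0 ≤ ∑ i, ∑ j, (star (c i) * c j) • X i j := by
  obtain ⟨Y, rfl⟩ := exists_eq_star_mul_self_of_nonneg hX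
  have : ∑ i, ∑ j, (star (c i) * c j) • (star Y * Y) i j =
      ∑ l, star (∑ j, c j • Y l j) * ∑ j, c j • Y l j := by
    simp only [mul_apply, star_apply, Finset.smul_sum, star_sum, star_smul, Finset.sum_mul,
      Finset.mul_sum, smul_mul_smul_comm]
    rw [Finset.sum_comm_cycle]
    exact Finset.sum_congr rfl fun l _ => Finset.sum_comm
  rw [this]
  exact Finset.sum_nonneg fun l _ => star_mul_self_nonneg _

lemma CStarMatrix.nonneg_of_posSemidef [DecidableEq k] {M : Matrix k k ℂ} (hM : M.PosSemidef) :
    0 ≤ CStarMatrix.ofMatrix M := by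
  open scoped MatrixOrder in
  obtain ⟨Y, hY⟩ := CStarAlgebra.nonneg_iff_eq_star_mul_self.mp hM.nonneg
  rw [hY]
  exact star_mul_self_nonneg (CStarMatrix.ofMatrix Y)

lemma CStarMatrix.norm_le_norm_apply (M : CStarMatrix (Fin 1) (Fin 1) B) : ‖M‖ ≤ ‖M 0 0‖ := by
  refine norm_le_of_forall_inner_le (C := ‖M 0 0‖₊) fun v w => ?_
  simp only [WithCStarModule.pi_inner, WithCStarModule.inner_def, toCLM_apply_eq_sum,
    WithCStarModule.equiv_symm_pi_apply, Finset.univ_unique, Fin.default_eq_zero,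
    Finset.sum_singleton, coe_nnnorm]
  calc ‖v 0 * M 0 0 * star (w 0)‖ ≤ ‖v 0‖ * ‖M 0 0‖ * ‖star (w 0)‖ :=
        (norm_mul_le _ _).trans (by gcongr; exact norm_mul_le _ _)
    _ = ‖M 0 0‖ * ‖v 0‖ * ‖w 0‖ := by rw [norm_star]; ring
    _ ≤ ‖M 0 0‖ * ‖v‖ * ‖w‖ := by
        gcongr <;> exact WithCStarModule.norm_apply_le_norm _ _

lemma CStarMatrix.nonneg_of_apply_nonneg {M : CStarMatrix (Fin 1) (Fin 1) B} (hM : 0 ≤ M 0 0) :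
    0 ≤ M := by
  obtain ⟨y, hy⟩ := exists_eq_star_mul_self_of_nonneg hM
  have : M = star (ofMatrix fun _ _ => y) * (ofMatrix fun _ _ => y) := by
    ext i j
    rw [Subsingleton.elim i 0, Subsingleton.elim j 0, hy]
    simp only [mul_apply, star_apply, Finset.univ_unique, Finset.sum_singleton]
    rfl
  rw [this]
  exact star_mul_self_nonneg _

lemma CStarMatrix.apply_nonneg {X : CStarMatrix k k B} (hX : 0 ≤ X) (i : k) : 0 ≤ X i i := by
  obtain ⟨Y, rfl⟩ := exists_eq_star_mul_self_of_nonneg hX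
  simp only [mul_apply, star_apply]
  exact Finset.sum_nonneg fun l _ => star_mul_self_nonneg _

end ScalarVectors

/-! ### Completely contractive completely positive functionals. -/

namespace SelfadjointOperatorSpace

variable {B : Type*} [NonUnitalCStarAlgebra B] [PartialOrder B] [StarOrderedRing B]

/-- The positive elements of a selfadjoint operator space. -/
def posElements (V : SelfadjointOperatorSpace B) : Set B := {P | P ∈ V.toSubmodule ∧ 0 ≤ P}

lemma toAmbient_apply {B : Type*} [NonUnitalCStarAlgebra B] (V : SelfadjointOperatorSpace B)
    {k : ℕ} (X : Matrix (Fin k) (Fin k) V)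
    (i j : Fin k) : V.toAmbient X i j = X i j := rfl

lemma IsCCP.apply_nonneg {V : SelfadjointOperatorSpace B} {φ : V →ₗ[ℂ] univ ℂ}
    (hφ : IsCCP V (univ ℂ) φ) {p : V} (hp : 0 ≤ (p : B)) : 0 ≤ (φ p : ℂ) := by
  have h := hφ.1.2 1 (fun _ _ => p) (CStarMatrix.nonneg_of_apply_nonneg hp)
  exact CStarMatrix.apply_nonneg (X := (univ ℂ).toAmbient _) h 0

lemma IsCCP.norm_apply_le {V : SelfadjointOperatorSpace B} {φ : V →ₗ[ℂ] univ ℂ}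
    (hφ : IsCCP V (univ ℂ) φ) (x : V) : ‖(φ x : ℂ)‖ ≤ ‖(x : B)‖ := by
  have h := hφ.2 1 (fun _ _ => x)
  have h1 := CStarMatrix.norm_entry_le_norm
    (M := (univ ℂ).toAmbient (Matrix.map (fun _ _ : Fin 1 => x) φ)) (i := 0) (j := 0)
  exact h1.trans (h.trans (CStarMatrix.norm_le_norm_apply _))

/-- Scalar matrices are tested on scalar vectors, and `φ` commutes with the resulting scalar
combinations of entries, so every matrix level reduces to the first. -/
lemma isCCP_of_nonneg_of_norm_le {V : SelfadjointOperatorSpace B} (φ : V →ₗ[ℂ] univ ℂ)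
    (hstar : ∀ x, φ (star x) = star (φ x))
    (hpos : ∀ p : V, 0 ≤ (p : B) → 0 ≤ (φ p : ℂ))
    (hnorm : ∀ x : V, ‖(φ x : ℂ)‖ ≤ ‖(x : B)‖) : IsCCP V (univ ℂ) φ := by
  have hsum {k : ℕ} (X : Matrix (Fin k) (Fin k) V) (c : Fin k → Fin k → ℂ) :
      (φ (∑ i, ∑ j, c i j • X i j) : ℂ) = ∑ i, ∑ j, c i j * (φ (X i j) : ℂ) := by
    simp [map_sum]
  refine ⟨⟨hstar, fun k X hX => ?_⟩, fun k X => ?_⟩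
  · refine CStarMatrix.nonneg_of_posSemidef (Matrix.PosSemidef.of_dotProduct_mulVec_nonneg ?_ ?_)
    · ext i j
      have h1 : star (X j i) = X i j := by
        apply Subtype.ext
        have := CStarMatrix.ext_iff.mpr
          (IsSelfAdjoint.of_nonneg (R := CStarMatrix (Fin k) (Fin k) B) hX).star_eq i j
        exact this
      have := congrArg Subtype.val (hstar (X j i))
      rw [h1] at this
      exact this.symm
    · intro c
      have h := hpos (∑ i, ∑ j, (star (c i) * c j) • X i j) (by
        have := CStarMatrix.sum_smul_nonneg (X := V.toAmbient X) hX c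
        simpa [toAmbient_apply] using this)
      rw [hsum] at h
      convert h using 1
      simp only [dotProduct, Matrix.mulVec, Finset.mul_sum, Matrix.map_apply, Pi.star_apply]
      refine Finset.sum_congr rfl fun i _ => Finset.sum_congr rfl fun j _ => ?_
      ring
  · refine CStarMatrix.norm_le_of_forall_inner_le (C := ‖V.toAmbient X‖₊) fun v w => ?_
    have h := hnorm (∑ i, ∑ j, (v i * star (w j)) • X i j)
    rw [hsum] at h
    have h2 := CStarMatrix.norm_sum_smul_le (V.toAmbient X) v w
    have h3 : (inner ℂ w (CStarMatrix.toCLM ((univ ℂ).toAmbient (X.map φ)) v) : ℂ) =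
        ∑ i, ∑ j, (v i * star (w j)) * (φ (X i j) : ℂ) := by
      rw [Finset.sum_comm]
      simp only [WithCStarModule.pi_inner, WithCStarModule.inner_def,
        CStarMatrix.toCLM_apply_eq_sum, WithCStarModule.equiv_symm_pi_apply, Finset.sum_mul]
      refine Finset.sum_congr rfl fun j _ => Finset.sum_congr rfl fun i _ => ?_
      rw [toAmbient_apply, Matrix.map_apply]
      ring
    rw [h3]
    refine h.trans ?_
    simpa [toAmbient_apply] using h2

/-! ### Sublinearity of the distance to the cone. -/

section Sublinear

variable (V : SelfadjointOperatorSpace B)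

lemma posElements_nonempty {B : Type*} [NonUnitalCStarAlgebra B] [PartialOrder B]
    (V : SelfadjointOperatorSpace B) : V.posElements.Nonempty := ⟨0, V.zero_mem, le_rfl⟩

lemma add_mem_posElements {p q : B} (hp : p ∈ V.posElements) (hq : q ∈ V.posElements) :
    p + q ∈ V.posElements :=
  ⟨V.add_mem hp.1 hq.1, add_nonneg hp.2 hq.2⟩

lemma smul_mem_posElements {p : B} {c : ℝ} (hc : 0 ≤ c) (hp : p ∈ V.posElements) :
    c • p ∈ V.posElements :=
  ⟨V.toSubmodule.smul_of_tower_mem c hp.1, smul_nonneg hc hp.2⟩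

lemma infDist_posElements_add_le (x y : B) :
    Metric.infDist (x + y) V.posElements ≤
      Metric.infDist x V.posElements + Metric.infDist y V.posElements := by
  refine le_of_forall_pos_lt_add fun ε hε => ?_
  obtain ⟨p, hp, hp'⟩ := (Metric.infDist_lt_iff V.posElements_nonempty).mp
    (lt_add_of_pos_right (Metric.infDist x V.posElements) (half_pos hε))
  obtain ⟨q, hq, hq'⟩ := (Metric.infDist_lt_iff V.posElements_nonempty).mp
    (lt_add_of_pos_right (Metric.infDist y V.posElements) (half_pos hε))
  have h1 := Metric.infDist_le_dist_of_mem (x := x + y) (V.add_mem_posElements hp hq)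
  have h2 := dist_add_add_le x y p q
  linarith

lemma infDist_posElements_smul_le {c : ℝ} (hc : 0 < c) (x : B) :
    Metric.infDist (c • x) V.posElements ≤ c * Metric.infDist x V.posElements := by
  rw [← div_le_iff₀' hc, Metric.le_infDist V.posElements_nonempty]
  intro p hp
  rw [div_le_iff₀' hc]
  calc _ ≤ dist (c • x) (c • p) :=
        Metric.infDist_le_dist_of_mem (V.smul_mem_posElements hc.le hp)
    _ = c * dist x p := by rw [dist_smul₀, Real.norm_of_nonneg hc.le]

lemma infDist_posElements_smul {c : ℝ} (hc : 0 < c) (x : B) :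
    Metric.infDist (c • x) V.posElements = c * Metric.infDist x V.posElements := by
  refine le_antisymm (V.infDist_posElements_smul_le hc x) ?_
  have := V.infDist_posElements_smul_le (inv_pos.mpr hc) (c • x)
  rwa [inv_smul_smul₀ hc.ne', ← div_eq_inv_mul, le_div_iff₀' hc] at this

lemma infDist_posElements_coe_smul {c : ℝ} (hc : 0 < c) (x : B) :
    Metric.infDist ((c : ℂ) • x) V.posElements = c * Metric.infDist x V.posElements := by
  rw [Complex.coe_smul, V.infDist_posElements_smul hc]

lemma infDist_posElements_le_norm {B : Type*} [NonUnitalCStarAlgebra B] [PartialOrder B]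
    (V : SelfadjointOperatorSpace B) (x : B) : Metric.infDist x V.posElements ≤ ‖x‖ := by
  simpa using Metric.infDist_le_dist_of_mem (x := x) (s := V.posElements) ⟨V.zero_mem, le_rfl⟩

end Sublinear

/-! ### Duality between the distance and functionals. -/

/-- For `p` in the cone, `-φ(y) ≤ φ(p - y) ≤ ‖p - y‖` in real parts, by positivity and
contractivity. -/
lemma IsCCP.neg_re_apply_le_infDist {V : SelfadjointOperatorSpace B} {φ : V →ₗ[ℂ] univ ℂ}
    (hφ : IsCCP V (univ ℂ) φ) (y : V) :
    -(φ y : ℂ).re ≤ Metric.infDist (y : B) V.posElements := by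
  rw [Metric.le_infDist V.posElements_nonempty]
  intro p hp
  have h1 : 0 ≤ (φ ⟨p, hp.1⟩ : ℂ).re := (Complex.le_def.mp (hφ.apply_nonneg hp.2)).1
  have h2 := hφ.norm_apply_le (⟨p, hp.1⟩ - y)
  have h3 := (Complex.re_le_norm _).trans h2
  have h4 : (φ (⟨p, hp.1⟩ - y) : ℂ).re = (φ ⟨p, hp.1⟩ : ℂ).re - (φ y : ℂ).re := by
    rw [map_sub]; rfl
  rw [h4] at h3
  have h5 : ‖((⟨p, hp.1⟩ - y : V) : B)‖ = dist (y : B) p := by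
    rw [dist_comm, dist_eq_norm]; rfl
  linarith

/-- Hahn–Banach, dominated by the sublinear distance `N`, yields a real functional `f ≤ N` with `f y
= N y`. Since `N` vanishes on the cone, `-f` is positive; since `N` is at most the norm, `-f` is
contractive. Symmetrising and complexifying `-f` preserves both. -/
lemma exists_isCCP_re_apply_eq_neg_infDist (V : SelfadjointOperatorSpace B) (y : V)
    (hy : star y = y) : ∃ φ : V →ₗ[ℂ] univ ℂ, IsCCP V (univ ℂ) φ ∧
      (φ y : ℂ).re = -Metric.infDist (y : B) V.posElements := by
  set N : V → ℝ := fun x => Metric.infDist (x : B) V.posElements with hN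
  have hNsmul (c : ℝ) (hc : 0 < c) (x : V) : N (c • x) = c * N x :=
    V.infDist_posElements_smul hc (x : B)
  have hNadd (x x' : V) : N (x + x') ≤ N x + N x' := V.infDist_posElements_add_le x x'
  have hN0 (x : V) : 0 ≤ N x := Metric.infDist_nonneg
  obtain ⟨f, hfy, hf⟩ : ∃ f : V →ₗ[ℝ] ℝ, f y = N y ∧ ∀ x, f x ≤ N x := by
    rcases eq_or_ne y 0 with rfl | hy0
    · refine ⟨0, ?_, hN0⟩
      have : N 0 ≤ 0 := (V.infDist_posElements_le_norm (0 : B)).trans_eq norm_zero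
      exact le_antisymm (hN0 0) this
    · obtain ⟨g, hg, hgN⟩ := exists_extension_of_le_sublinear
        (LinearPMap.mkSpanSingleton (K := ℝ) y (N y) hy0) N hNsmul hNadd (by
          rintro ⟨x, hx⟩
          obtain ⟨c, rfl⟩ := Submodule.mem_span_singleton.mp hx
          have h := LinearPMap.mkSpanSingleton'_apply (R := ℝ) y (N y)
            (fun c hc => by rw [(smul_eq_zero.mp hc).resolve_right hy0, map_zero, zero_smul]) c hx
          refine h.trans_le ?_
          rw [smul_eq_mul]
          rcases le_or_gt c 0 with hc | hc
          · exact (mul_nonpos_of_nonpos_of_nonneg hc (hN0 _)).trans (hN0 _)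
          · exact (hNsmul c hc y).ge)
      refine ⟨g, ?_, hgN⟩
      have h1 := hg ⟨y, Submodule.mem_span_singleton_self y⟩
      have h2 := LinearPMap.mkSpanSingleton_apply ℝ ℝ (σ := RingHom.id ℝ) hy0 (N y)
      exact h1.trans h2
  have hstar_add (a b : V) : star (a + b) = star a + star b := Subtype.ext (star_add (a : B) b)
  have hstar_smul (c : ℂ) (a : V) : star (c • a) = star c • star a :=
    Subtype.ext (star_smul c (a : B))
  have hstar_smul' (c : ℝ) (a : V) : star (c • a) = c • star a :=
    Subtype.ext ((star_smul c (a : B)).trans (by rw [star_trivial]; rfl))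
  have hstar_star (a : V) : star (star a) = a := Subtype.ext (star_star (a : B))
  let g : Module.Dual ℝ V :=
    { toFun := fun x => -(f x + f (star x)) / 2
      map_add' := fun a b => by simp only [hstar_add, map_add]; ring
      map_smul' := fun c a => by
        simp only [hstar_smul', map_smul, smul_eq_mul, RingHom.id_apply]; ring }
  have hg (x : V) : g x = -(f x + f (star x)) / 2 := rfl
  have hgstar (x : V) : g (star x) = g x := by rw [hg, hg, hstar_star, add_comm]
  let h : Module.Dual ℂ V := g.extendRCLike
  have hre (x : V) : (h x).re = g x := Module.Dual.re_extendRCLike_apply (𝕜 := ℂ) g x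
  have hstar (x : V) : h (star x) = star (h x) := by
    have hI : g (Complex.I • star x) = -g (Complex.I • x) := by
      rw [← map_neg, ← hgstar]
      congr 1
      rw [hstar_smul, hstar_star]
      simp
    have e (x : V) : h x = (g x : ℂ) - Complex.I * (g (Complex.I • x) : ℂ) :=
      Module.Dual.extendRCLike_apply (𝕜 := ℂ) g x
    rw [e, e, hI, hgstar]
    simp
  have hle (x : V) : g x ≤ ‖(x : B)‖ := by
    have e : g x = (f (-x) + f (star (-x))) / 2 := by
      have : star (-x) = -star x := Subtype.ext (star_neg (x : B))
      rw [hg, this, map_neg, map_neg]; ring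
    have h1 := (hf (-x)).trans (V.infDist_posElements_le_norm ((-x : V) : B))
    have h2 := (hf (star (-x))).trans (V.infDist_posElements_le_norm ((star (-x) : V) : B))
    have h3 : ‖((-x : V) : B)‖ = ‖(x : B)‖ := norm_neg (x : B)
    have h4 : ‖((star (-x) : V) : B)‖ = ‖(x : B)‖ := (norm_star _).trans h3
    linarith
  refine ⟨h.codRestrict (univ ℂ).toSubmodule fun _ => trivial, ?_, ?_⟩
  · refine isCCP_of_nonneg_of_norm_le _ (fun x => Subtype.ext (hstar x)) (fun p hp => ?_)
      (fun x => ?_)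
    · have hps : star p = p := Subtype.ext (IsSelfAdjoint.of_nonneg hp).star_eq
      have hNp : N p = 0 := Metric.infDist_zero_of_mem ⟨p.2, hp⟩
      have h1 : 0 ≤ g p := by
        have := hf p
        rw [hg, hps]
        linarith
      have h2 : star (h p) = h p := by rw [← hstar, hps]
      have h3 : 0 ≤ h p := by
        rw [Complex.le_def]
        exact ⟨by rw [hre]; exact h1, (Complex.conj_eq_iff_im.mp h2).symm⟩
      exact h3
    -- Multiplying `x` by the conjugate of `h x` makes the value real, so the bound on `g` controls
    -- the modulus of `h x`.
    · have h1 : ‖h x‖ ^ 2 = g (star (h x) • x) := Module.Dual.norm_extendRCLike_apply_sq g x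
      have h2 := hle (star (h x) • x)
      rw [← h1, Submodule.coe_smul, norm_smul, norm_star, sq] at h2
      change ‖h x‖ ≤ _
      rcases (norm_nonneg (h x)).eq_or_lt with h0 | h0
      · rw [← h0]; exact norm_nonneg _
      · exact le_of_mul_le_mul_left h2 h0
  · change (h y).re = _
    rw [hre, hg, hy, hfy]
    ring

lemma infDist_posElements_le_one_iff (V : SelfadjointOperatorSpace B) (y : V)
    (hy : star y = y) : Metric.infDist (y : B) V.posElements ≤ 1 ↔
      ∀ φ : V →ₗ[ℂ] univ ℂ, IsCCP V (univ ℂ) φ → -1 ≤ (φ y : ℂ).re := by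
  refine ⟨fun h φ hφ => ?_, fun h => ?_⟩
  · linarith [hφ.neg_re_apply_le_infDist y]
  · obtain ⟨φ, hφ, hφy⟩ := V.exists_isCCP_re_apply_eq_neg_infDist y hy
    linarith [h φ hφ]

/-! ### Unitisation cones as distance conditions. -/

open scoped MatrixOrder in
lemma rpow_neg_half_isHermitian {n : ℕ} (a : Matrix (Fin n) (Fin n) ℂ) :
    (a ^ (-(1 / 2) : ℝ)).IsHermitian :=
  (Matrix.nonneg_iff_posSemidef.mp CFC.rpow_nonneg).1

open scoped MatrixOrder in
lemma smul_one_rpow {n : ℕ} {r : ℝ} (hr : 0 ≤ r) (s : ℝ) :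
    ((r : ℂ) • (1 : Matrix (Fin n) (Fin n) ℂ)) ^ s = ((r ^ s : ℝ) : ℂ) • 1 := by
  lift r to NNReal using hr
  have h := CFC.rpow_algebraMap (A := Matrix (Fin n) (Fin n) ℂ) (x := r) (y := s)
  have e (q : NNReal) : algebraMap NNReal (Matrix (Fin n) (Fin n) ℂ) q = ((q : ℝ) : ℂ) • 1 := by
    ext i j
    rw [Algebra.algebraMap_eq_smul_one]
    rfl
  rw [e, e] at h
  simpa using h

section

variable {A : Type*} [NonUnitalCStarAlgebra A] [PartialOrder A] [StarOrderedRing A]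

lemma star_sandwich (E : SelfadjointOperatorSpace A) {n : ℕ} {b : Matrix (Fin n) (Fin n) ℂ}
    (hb : b.IsHermitian) {X : Matrix (Fin n) (Fin n) E} (hX : ∀ i j, X j i = star (X i j)) :
    star (E.sandwich b X) = E.sandwich b X := by
  apply Subtype.ext
  apply CStarMatrix.ext
  intro i j
  have hX' (k l : Fin n) : star (X k l : A) = X l k := congrArg Subtype.val (hX k l).symm
  change star ((∑ k, ∑ l, (b j k * b l i) • X k l : E) : A) =
    ((∑ k, ∑ l, (b i k * b l j) • X k l : E) : A)
  simp only [Submodule.coe_sum, Submodule.coe_smul, star_sum, star_smul, hX', star_mul']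
  rw [Finset.sum_comm]
  refine Finset.sum_congr rfl fun k _ => Finset.sum_congr rfl fun l _ => ?_
  rw [hb.apply, hb.apply, mul_comm]

lemma sandwich_smul_one (E : SelfadjointOperatorSpace A) {n : ℕ} (r : ℂ)
    (X : Matrix (Fin n) (Fin n) E) :
    (E.sandwich (r • 1) X : CStarMatrix (Fin n) (Fin n) A) = (r * r) • E.toAmbient X := by
  apply CStarMatrix.ext
  intro i j
  change ((∑ k, ∑ l, ((r • 1 : Matrix _ _ ℂ) i k * (r • 1 : Matrix _ _ ℂ) l j) • X k l : E) : A) =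
    (r * r) • (X i j : A)
  simp [Matrix.one_apply, Finset.sum_ite_eq, ite_smul, mul_ite]

open scoped MatrixOrder in
lemma mem_unitisationCone_iff (E : SelfadjointOperatorSpace A) {n : ℕ}
    (u : Matrix (Fin n) (Fin n) (E × ℂ)) :
    u ∈ E.unitisationCone n ↔ (∀ i j, u j i = star (u i j)) ∧ (u.map Prod.snd).PosSemidef ∧
      ∀ ε : ℝ, 0 < ε → Metric.infDist (E.sandwich
        ((u.map Prod.snd + (ε : ℂ) • (1 : Matrix (Fin n) (Fin n) ℂ)) ^ (-(1 / 2) : ℝ))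
        (u.map Prod.fst) : CStarMatrix (Fin n) (Fin n) A) (E.posCone n) ≤ 1 := by
  refine and_congr_right fun hu => and_congr_right fun _ => forall₂_congr fun ε _ => ?_
  refine ((E.mat n).infDist_posElements_le_one_iff _ (E.star_sandwich
    (rpow_neg_half_isHermitian _) fun i j => ?_)).symm
  exact congrArg Prod.fst (hu i j)

lemma infDist_sandwich_le_one_iff (E : SelfadjointOperatorSpace A) {n : ℕ} {r : ℝ} (hr : 0 < r)
    (X : Matrix (Fin n) (Fin n) E) :
    Metric.infDist (E.sandwich (((r ^ (-(1 / 2) : ℝ) : ℝ) : ℂ) • 1) X :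
      CStarMatrix (Fin n) (Fin n) A) (E.posCone n) ≤ 1 ↔
      Metric.infDist (E.toAmbient X) (E.posCone n) ≤ r := by
  have h : ((r ^ (-(1 / 2) : ℝ) : ℝ) : ℂ) * ((r ^ (-(1 / 2) : ℝ) : ℝ) : ℂ) = (r⁻¹ : ℝ) := by
    rw [← Complex.ofReal_mul, ← Real.rpow_add hr, ← Real.rpow_neg_one]
    norm_num
  have h2 := (E.mat n).infDist_posElements_coe_smul (inv_pos.mpr hr) (E.toAmbient X)
  change Metric.infDist _ (E.posCone n) = _ * Metric.infDist _ (E.posCone n) at h2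
  rw [sandwich_smul_one, h, h2, ← div_eq_inv_mul, div_le_one hr]

lemma posCone_univ (n : ℕ) :
    (univ A).posCone n = {P : CStarMatrix (Fin n) (Fin n) A | 0 ≤ P} :=
  Set.ext fun _ => ⟨fun h => h.2, fun h => ⟨fun _ _ => trivial, h⟩⟩

lemma sandwich_map_inclusion (E : SelfadjointOperatorSpace A) {n : ℕ}
    (b : Matrix (Fin n) (Fin n) ℂ) (X : Matrix (Fin n) (Fin n) E) :
    ((univ A).sandwich b (X.map E.inclusion) : CStarMatrix (Fin n) (Fin n) A) =
      E.sandwich b X := by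
  apply CStarMatrix.ext
  intro i j
  change ((∑ k, ∑ l, (b i k * b l j) • E.inclusion (X k l) : univ A) : A) =
    ((∑ k, ∑ l, (b i k * b l j) • X k l : E) : A)
  simp only [Submodule.coe_sum, Submodule.coe_smul]
  rfl

open scoped MatrixOrder in
lemma map_mem_unitisationCone_univ_iff (E : SelfadjointOperatorSpace A) {n : ℕ}
    (u : Matrix (Fin n) (Fin n) (E × ℂ)) :
    u.map (unitisationMap E (univ A) E.inclusion) ∈ (univ A).unitisationCone n ↔
      (∀ i j, u j i = star (u i j)) ∧ (u.map Prod.snd).PosSemidef ∧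
      ∀ ε : ℝ, 0 < ε → Metric.infDist (E.sandwich
        ((u.map Prod.snd + (ε : ℂ) • (1 : Matrix (Fin n) (Fin n) ℂ)) ^ (-(1 / 2) : ℝ))
        (u.map Prod.fst) : CStarMatrix (Fin n) (Fin n) A) ((univ A).posCone n) ≤ 1 := by
  have hsnd : (u.map (unitisationMap E (univ A) E.inclusion)).map Prod.snd = u.map Prod.snd := rfl
  have hfst : (u.map (unitisationMap E (univ A) E.inclusion)).map Prod.fst =
    (u.map Prod.fst).map E.inclusion := rfl
  rw [mem_unitisationCone_iff, hsnd, hfst]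
  refine and_congr ?_ (and_congr_right fun _ => forall₂_congr fun ε _ => ?_)
  · refine forall₂_congr fun i j => ⟨fun h => ?_, fun h => ?_⟩
    · have h1 : ((u j i).1 : A) = star ((u i j).1 : A) := congrArg (fun p => (p.1 : A)) h
      have h2 : (u j i).2 = star (u i j).2 := congrArg Prod.snd h
      exact Prod.ext (Subtype.ext h1) h2
    · have h1 : ((u j i).1 : A) = star ((u i j).1 : A) := congrArg (fun p => (p.1 : A)) h
      have h2 : (u j i).2 = star (u i j).2 := congrArg Prod.snd h
      exact Prod.ext (Subtype.ext h1) h2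
  · rw [sandwich_map_inclusion]

lemma infDist_posCone_univ_le (E : SelfadjointOperatorSpace A) {n : ℕ}
    (x : CStarMatrix (Fin n) (Fin n) A) :
    Metric.infDist x ((univ A).posCone n) ≤ Metric.infDist x (E.posCone n) :=
  Metric.infDist_le_infDist_of_subset (fun _ hP => ⟨fun _ _ => trivial, hP.2⟩)
    (E.mat n).posElements_nonempty

-- For `a = d·1` the sandwich is scaling by `(d + ε)⁻¹`, so the condition reads `dist ≤ d + ε` for
-- all `ε > 0`.
open scoped MatrixOrder in
lemma mem_unitisationCone_iff_of_snd_eq_smul_one {E : SelfadjointOperatorSpace A} {n : ℕ}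
    {u : Matrix (Fin n) (Fin n) (E × ℂ)} {d : ℝ} (hd : 0 ≤ d)
    (hu : ∀ i j, u j i = star (u i j)) (hud : u.map Prod.snd = (d : ℂ) • 1) :
    u ∈ E.unitisationCone n ↔ Metric.infDist (E.toAmbient (u.map Prod.fst)) (E.posCone n) ≤ d := by
  have hpos : (u.map Prod.snd).PosSemidef := by
    rw [hud]
    exact Matrix.PosSemidef.one.smul (by simpa using hd)
  rw [mem_unitisationCone_iff, and_iff_right hu, and_iff_right hpos]
  have key (ε : ℝ) (hε : 0 < ε) := E.infDist_sandwich_le_one_iff (n := n) (r := d + ε)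
    (by linarith) (u.map Prod.fst)
  have hb (ε : ℝ) (hε : 0 < ε) : (u.map Prod.snd +
      (ε : ℂ) • (1 : Matrix (Fin n) (Fin n) ℂ)) ^ (-(1 / 2) : ℝ) =
        (((d + ε) ^ (-(1 / 2) : ℝ) : ℝ) : ℂ) • 1 := by
    rw [hud, ← add_smul, ← Complex.ofReal_add, smul_one_rpow (by linarith)]
  constructor
  · intro h
    refine le_of_forall_pos_le_add fun ε hε => (key ε hε).mp ?_
    rw [← hb ε hε]
    exact h ε hε
  · intro h ε hε
    rw [hb ε hε]
    exact (key ε hε).mpr (h.trans (by linarith))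

/-! ### Embeddings and equality of distances. -/

lemma isEmbedding_inclusion_iff_infDist_eq (E : SelfadjointOperatorSpace A) :
    IsEmbedding E (univ A) E.inclusion ↔ ∀ (n : ℕ) (x : CStarMatrix (Fin n) (Fin n) A),
      x ∈ (E.mat n).toSubmodule → IsSelfAdjoint x →
        Metric.infDist x (E.posCone n) = Metric.infDist x ((univ A).posCone n) := by
  constructor
  · rintro ⟨-, -, -, -, h⟩ n x hx hxs
    refine le_antisymm ?_ (E.infDist_posCone_univ_le x)
    -- This is the least `d` for which `(x, d·1)` is positive in the unitisation of the C*-algebra.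
    -- Reflecting that positivity to `E^#` bounds the distance to the smaller cone by `d`.
    set d := Metric.infDist x ((univ A).posCone n) with hd
    have hd0 : 0 ≤ d := Metric.infDist_nonneg
    let u : Matrix (Fin n) (Fin n) (E × ℂ) := fun i j => (⟨x i j, hx i j⟩, ((d : ℂ) • 1 :
      Matrix (Fin n) (Fin n) ℂ) i j)
    have hu (i j : Fin n) : u j i = star (u i j) := by
      refine Prod.ext (Subtype.ext ?_) ?_
      · exact (CStarMatrix.ext_iff.mpr hxs.star_eq j i).symm
      · change ((d : ℂ) • 1 : Matrix (Fin n) (Fin n) ℂ) j i =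
          star (((d : ℂ) • 1 : Matrix (Fin n) (Fin n) ℂ) i j)
        by_cases hij : i = j
        · simp [hij]
        · simp [hij, Ne.symm hij]
    refine (mem_unitisationCone_iff_of_snd_eq_smul_one hd0 hu rfl).mp (h n u ?_)
    refine (mem_unitisationCone_iff_of_snd_eq_smul_one hd0 (fun i j => ?_) rfl).mpr hd.ge
    rw [Matrix.map_apply, Matrix.map_apply, hu i j]
    rfl
  · intro h
    refine ⟨fun _ _ => rfl, ⟨⟨fun _ => rfl, fun _ _ hX => hX⟩, Submodule.inclusion_injective _,
      fun _ _ hX => hX⟩, ⟨fun _ => rfl, fun n u hu => ?_⟩, ?_, fun n u hu => ?_⟩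
    · rw [mem_unitisationCone_iff] at hu
      rw [map_mem_unitisationCone_univ_iff]
      exact ⟨hu.1, hu.2.1, fun ε hε => (E.infDist_posCone_univ_le _).trans (hu.2.2 ε hε)⟩
    · exact Function.Injective.prodMap (f := E.inclusion)
        (Submodule.inclusion_injective (p := E.toSubmodule) le_top) Function.injective_id
    · rw [map_mem_unitisationCone_univ_iff] at hu
      rw [mem_unitisationCone_iff]
      refine ⟨hu.1, hu.2.1, fun ε hε => ?_⟩
      -- The hypothesis is applied to the sandwich, which is selfadjoint and lies in `M_n(E)`.
      rw [h n _ (Subtype.property _)]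
      · exact hu.2.2 ε hε
      · exact congrArg Subtype.val (E.star_sandwich (rpow_neg_half_isHermitian _)
          fun i j => congrArg Prod.fst (hu.1 i j))

end

end SelfadjointOperatorSpace

theorem corollary3p4 {C : Type*} [NonUnitalCStarAlgebra C] [PartialOrder C] [StarOrderedRing C]
    (E : SelfadjointOperatorSpace C) :
    SelfadjointOperatorSpace.IsEmbedding E (SelfadjointOperatorSpace.univ C) E.inclusion ↔
      ∀ (n : ℕ) (x : CStarMatrix (Fin n) (Fin n) C), x ∈ (E.mat n).toSubmodule →
        IsSelfAdjoint x →
        IsGreatest {t : ℝ | -(t : ℂ) ∈ quasispectrum ℂ x} (Metric.infDist x (E.posCone n)) := by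
  rw [SelfadjointOperatorSpace.isEmbedding_inclusion_iff_infDist_eq]
  refine forall₂_congr fun n x => forall₂_congr fun _ hx => ?_
  have h := isGreatest_neg_mem_quasispectrum x hx
  rw [← infDist_nonneg_eq_norm_negPart x hx, ← SelfadjointOperatorSpace.posCone_univ] at h
  exact ⟨fun e => e ▸ h, fun h' => h'.unique h⟩
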